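/- Let $n \geq 2$ and $[n] = \{1,\dots,n\}$. Let $\tilde S_n$ be the affine symmetric group, that is, the group of bijections $w : \mathbb{Z} \to \mathbb{Z}$ with $w(i+n) = w(i)+n$ for all $i \in \mathbb{Z}$ and $\sum_{i\in[n]} w(i) = \sum_{i \in [n]} i$. Let $S = \{s_0, s_1, \dots, s_{n-1}\}$ be its set of simple generators, where $s_i$ maps $j$ to $j+1$ if $j \equiv i \pmod n$, to $j-1$ if $j \equiv i+1 \pmod n$, and to $j$ otherwise, and let $\ell$ be the length function with respect to $S$. Let $w \mapsto w^* = \tau_n w \tau_n$ be the automorphism of $\tilde S_n$ given by conjugation by $\tau_n : i \mapsto n+1-i$, and let $\mathbf{I}_* = \{ w \in \tilde S_n : w^{-1} = w^*\}$ be the set of $*$-twisted involutions. The twisted absolute length function is the unique map $\hat\ell_* : \mathbf{I}_* \to \mathbb{N}$ such that (a) $\hat\ell_*(1) = 0$; (b) $\hat\ell_*(s w s^*) = \hat\ell_*(w)$ for all $s \in S$ and $w \in \mathbf{I}_*$; (c) $\hat\ell_*(ws) - \hat\ell_*(w) = \ell(ws) - \ell(w)$ whenever $s \in S$ and $w \in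 \mathbf{I}_*$ are such that $ws \in \mathbf{I}_*$. There is exactly one such map, and for every $w \in \mathbf{I}_*$ it satisfies $$\hat\ell_*(w) = \left\lfloor \frac{\#\{ i \in [n] : w(i) \equiv 1-i \ (\mathrm{mod}\ n)\}}{2} \right\rfloor.$$ -/

import Mathlib

/-! ### Twisted involutions and the twisted absolute length function -/

namespace TwistedCoxeter

variable {W : Type*} [Group W]

/-- The length of `w` with respect to a generating set `S` (of involutions): the least `k` such
that `w` is a product of `k` elements of `S`.  If `S` is the set of simple generators of a Coxeter
group, this is the Coxeter length function. -/
noncomputable def length (S : Set W) (w : W) : ℕ :=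
  sInf {k | ∃ l : List W, (∀ s ∈ l, s ∈ S) ∧ l.length = k ∧ l.prod = w}

/-- The set of `θ`-twisted involutions: the elements `w` with `w⁻¹ = θ w`. -/
def twistedInvolutions (θ : W ≃* W) : Set W := {w | w⁻¹ = θ w}

/-- `f` satisfies the three conditions that characterize the twisted absolute length function of
`(W, S)` with respect to the involutive automorphism `θ` (which preserves `S`). -/
structure IsTwistedAbsoluteLength (S : Set W) (θ : W ≃* W)
    (f : twistedInvolutions θ → ℕ) : Prop where
  map_one : ∀ e : twistedInvolutions θ, (e : W) = 1 → f e = 0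
  map_conj : ∀ s ∈ S, ∀ w w' : twistedInvolutions θ, (w' : W) = s * w * θ s → f w' = f w
  map_mul : ∀ s ∈ S, ∀ w w' : twistedInvolutions θ, (w' : W) = w * s →
    (f w' : ℤ) - (f w : ℤ) = (length S (w' : W) : ℤ) - (length S (w : W) : ℤ)

end TwistedCoxeter

/-! ### The affine symmetric group -/

namespace AffineSymmetric

open Finset

/-- A sum of a function of period `n` over a full period is unchanged when one precomposes with an
injection of `ℤ` that commutes with the shift by `n`. -/
theorem sum_comp_eq {n : ℕ} {d w : ℤ → ℤ} (hd : Function.Periodic d n)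
    (hw : ∀ i, w (i + n) = w i + n) (hi : Function.Injective w) :
    ∑ i ∈ Icc (1 : ℤ) n, d (w i) = ∑ i ∈ Icc (1 : ℤ) n, d i := by
  rcases Nat.eq_zero_or_pos n with rfl | hn
  · simp
  have hn' : (0 : ℤ) < n := by exact_mod_cast hn
  have hp : Function.Periodic (fun i => w i - i) (n : ℤ) := by
    intro i
    simp only [hw]
    ring
  have hmap : ∀ i ∈ Icc (1 : ℤ) n, (w i - 1) % n + 1 ∈ Icc (1 : ℤ) n := by
    intro i _
    have h1 := Int.emod_nonneg (w i - 1) hn'.ne'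
    have h2 := Int.emod_lt_of_pos (w i - 1) hn'
    simp only [mem_Icc]
    omega
  have hinj : Set.InjOn (fun i => (w i - 1) % n + 1) (Icc (1 : ℤ) n : Finset ℤ) := by
    intro i hi' j hj' hij
    simp only [add_left_inj] at hij
    obtain ⟨k, hk⟩ := (Int.ModEq.dvd hij : (n : ℤ) ∣ (w j - 1) - (w i - 1))
    have h1 := hp.int_mul k i
    simp only [Int.cast_id] at h1
    have h2 : w j = w (i + k * n) := by linarith [mul_comm (n : ℤ) k]
    have h3 : j = i + k * n := hi h2
    simp only [coe_Icc, Set.mem_Icc] at hi' hj'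
    have h4 : k = 0 := by
      by_contra h
      rcases lt_or_gt_of_ne h with h | h <;> nlinarith
    simp [h3, h4]
  refine sum_nbij (fun i => (w i - 1) % n + 1) hmap hinj
    (surjOn_of_injOn_of_card_le _ hmap hinj le_rfl) ?_
  intro i _
  have h := hd.int_mul ((w i - 1) / n) ((w i - 1) % n + 1)
  rw [← h, Int.cast_id]
  congr 1
  linarith [Int.emod_add_mul_ediv (w i - 1) n, mul_comm (n : ℤ) ((w i - 1) / n)]

/-- The affine symmetric group of rank `n`: the bijections `w : ℤ → ℤ` with `w (i + n) = w i + n`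
for all `i` and `w 1 + ⋯ + w n = 1 + ⋯ + n`. -/
def affineSymmetricGroup (n : ℕ) : Subgroup (Equiv.Perm ℤ) where
  carrier := {w | (∀ i : ℤ, w (i + n) = w i + n) ∧
    ∑ i ∈ Icc (1 : ℤ) n, w i = ∑ i ∈ Icc (1 : ℤ) n, i}
  one_mem' := by simp
  mul_mem' := by
    rintro v w ⟨hv, hv'⟩ ⟨hw, hw'⟩
    refine ⟨fun i => by simp [hv, hw], ?_⟩
    have h := sum_comp_eq (d := fun i => v i - i) (w := w) (n := n)
      (fun i => by simp only [hv]; ring) hw w.injective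
    simp only [sum_sub_distrib] at h
    simp only [Equiv.Perm.mul_apply]
    linarith
  inv_mem' := by
    rintro w ⟨hw, hw'⟩
    have hi : ∀ i : ℤ, w⁻¹ (i + n) = w⁻¹ i + n := fun i => by
      rw [Equiv.Perm.inv_eq_iff_eq, hw, show w (w⁻¹ i) = i from w.apply_symm_apply i]
    refine ⟨hi, ?_⟩
    have h := sum_comp_eq (d := fun i => w⁻¹ i - i) (w := w) (n := n)
      (fun i => by simp only [hi]; ring) hw w.injective
    simp only [sum_sub_distrib, show ∀ i, w⁻¹ (w i) = i from w.symm_apply_apply] at h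
    linarith

/-- The reflection `i ↦ n + 1 - i` of `ℤ`. -/
def tau (n : ℕ) : Equiv.Perm ℤ :=
  Function.Involutive.toPerm (fun i : ℤ => (n : ℤ) + 1 - i) (fun i => by simp)

theorem tau_apply (n : ℕ) (i : ℤ) : tau n i = n + 1 - i := rfl

theorem tau_conj_mem (n : ℕ) {w : Equiv.Perm ℤ} (hw : w ∈ affineSymmetricGroup n) :
    tau n * w * tau n ∈ affineSymmetricGroup n := by
  obtain ⟨hw, hw'⟩ := hw
  refine ⟨fun i => ?_, ?_⟩
  · have h := hw ((n : ℤ) + 1 - (i + n))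
    rw [show (n : ℤ) + 1 - (i + n) + n = n + 1 - i by ring] at h
    simp only [tau_apply, Equiv.Perm.mul_apply, h]
    ring
  · have href : ∀ f : ℤ → ℤ,
        ∑ i ∈ Icc (1 : ℤ) n, f ((n : ℤ) + 1 - i) = ∑ i ∈ Icc (1 : ℤ) n, f i := by
      intro f
      refine sum_nbij' (fun i => (n : ℤ) + 1 - i) (fun i => (n : ℤ) + 1 - i) ?_ ?_ ?_ ?_ ?_ <;>
        intro i hi <;> simp only [mem_Icc] at * <;> omega
    have h1 := href (fun i => w i)
    have h2 := href (fun i => (n : ℤ) + 1 - i)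
    simp only [sub_sub_cancel] at h2
    simp only [tau_apply, Equiv.Perm.mul_apply]
    rw [sum_sub_distrib, h1, hw', h2, ← sum_sub_distrib]
    simp only [sub_sub_cancel]
    exact h2

/-- The automorphism `w ↦ w^* = τ w τ` of the affine symmetric group. -/
def star (n : ℕ) : affineSymmetricGroup n ≃* affineSymmetricGroup n where
  toFun w := ⟨tau n * w * tau n, tau_conj_mem n w.2⟩
  invFun w := ⟨tau n * w * tau n, tau_conj_mem n w.2⟩
  left_inv w := by
    ext i; simp [tau_apply]
  right_inv w := by
    ext i; simp [tau_apply]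
  map_mul' v w := by
    ext i; simp [tau_apply]

/-- The map `j ↦ j + 1` if `j ≡ i`, `j ↦ j - 1` if `j ≡ i + 1`, and `j ↦ j` otherwise, where the
congruences are modulo `n`. -/
def simpleFun (n : ℕ) (i j : ℤ) : ℤ :=
  if j ≡ i [ZMOD n] then j + 1 else if j ≡ i + 1 [ZMOD n] then j - 1 else j

theorem simpleFun_involutive {n : ℕ} (hn : 2 ≤ n) (i : ℤ) :
    Function.Involutive (simpleFun n i) := by
  have key : ∀ j : ℤ, j ≡ i [ZMOD n] → ¬ j ≡ i + 1 [ZMOD n] := by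
    intro j h1 h2
    have h3 := (Int.ModEq.symm h1).trans h2
    have h4 := Int.le_of_dvd (by norm_num) (by simpa using h3.dvd : (n : ℤ) ∣ 1)
    omega
  intro j
  unfold simpleFun
  by_cases h1 : j ≡ i [ZMOD n]
  · have h2 : j + 1 ≡ i + 1 [ZMOD n] := h1.add_right 1
    have h3 : ¬ j + 1 ≡ i [ZMOD n] := fun h => key _ h h2
    simp [h1, h2, h3]
  · by_cases h2 : j ≡ i + 1 [ZMOD n]
    · have h3 : j - 1 ≡ i [ZMOD n] := by simpa using h2.sub_right 1
      simp only [h1, h2, h3, if_true, if_false]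
      ring
    · simp [h1, h2]

theorem simple_mem {n : ℕ} (hn : 2 ≤ n) (i : ℤ) :
    (simpleFun_involutive hn i).toPerm ∈ affineSymmetricGroup n := by
  have hper : ∀ a : ℤ, ∀ j : ℤ, j + n ≡ a [ZMOD n] ↔ j ≡ a [ZMOD n] := by
    intro a j
    simp [Int.ModEq]
  have hshift : ∀ j : ℤ, j ≡ i + 1 [ZMOD n] ↔ j - 1 ≡ i [ZMOD n] := fun j =>
    ⟨fun h => by simpa using h.sub_right 1, fun h => by simpa using h.add_right 1⟩
  refine ⟨fun j => ?_, ?_⟩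
  · simp only [Function.Involutive.coe_toPerm, simpleFun, hper]
    split_ifs <;> ring
  · let e : ℤ → ℤ := fun j => if j ≡ i [ZMOD n] then 1 else 0
    have hs := sum_comp_eq (n := n) (d := e) (w := fun j => j - 1)
      (fun j => by simp only [e, hper]) (fun j => by ring) (fun a b h => by simpa using h)
    have hj : ∀ j : ℤ, simpleFun n i j = j + (e j - e (j - 1)) := by
      intro j
      simp only [simpleFun, e, hshift]
      by_cases h1 : j ≡ i [ZMOD n]
      · have h2 : ¬ j - 1 ≡ i [ZMOD n] := by
          intro h
          have h4 := Int.le_of_dvd (by norm_num)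
            (by simpa using (h.trans h1.symm).dvd : (n : ℤ) ∣ 1)
          omega
        simp [h1, h2]
      · by_cases h2 : j - 1 ≡ i [ZMOD n] <;> simp [h1, h2]
        ring
    simp only [Function.Involutive.coe_toPerm, hj, sum_add_distrib, sum_sub_distrib]
    rw [hs]
    ring

/-- The simple generator `s_i` of the affine symmetric group. -/
def simple {n : ℕ} (hn : 2 ≤ n) (i : Fin n) : affineSymmetricGroup n :=
  ⟨(simpleFun_involutive hn (i : ℕ)).toPerm, simple_mem hn (i : ℕ)⟩

/-- The set `{s_0, s_1, …, s_{n-1}}` of simple generators of the affine symmetric group. -/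
def simples {n : ℕ} (hn : 2 ≤ n) : Set (affineSymmetricGroup n) := Set.range (simple hn)

end AffineSymmetric

namespace AffineSymmetric

open Finset

/-! Let `N w` be `antifixedCount w`, the number of residues `i` with `w i ≡ 1 - i`. Existence holds
because `N / 2` meets the three conditions. At the identity, `2 * i ≡ 1` has at most one solution
modulo `n`. Twisted conjugation by `s` only reindexes the counted residues, since `1 - s^* c ≡ s (1
- c)` (`antifixedCount_conj`). If `w` and `w * s_a` are both twisted involutions, then `w * s_a =
s_{-a} * w`, so `w` maps `a, a + 1` to consecutive integers in classes `-a, 1 - a`, in one order or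
the other. Passing from increasing to decreasing order adds exactly `a` and `a + 1` to the count,
while the length grows by one (`antifixedCount_mul_simpleInt_of_lt`).

Lengths are handled by `length_eq_inversionNumber`. Uniqueness is induction on length: at a descent
`s` of `w ≠ 1`, either `w * s` or `s^* * w * s` is a shorter twisted involution, and the conditions
carry its value back to `w`. -/

theorem simpleFun_of_modEq {n : ℕ} {a c : ℤ} (h : c ≡ a [ZMOD n]) :
    simpleFun n a c = c + 1 := if_pos h

theorem not_add_one_modEq_self {n : ℕ} (hn : 2 ≤ n) (a : ℤ) : ¬ a + 1 ≡ a [ZMOD n] := by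
  intro h
  have := Int.le_of_dvd (by norm_num) (by simpa using h.symm.dvd : (n : ℤ) ∣ 1)
  omega

theorem simpleFun_of_modEq_add_one {n : ℕ} (hn : 2 ≤ n) {a c : ℤ} (h : c ≡ a + 1 [ZMOD n]) :
    simpleFun n a c = c - 1 := by
  rw [simpleFun, if_neg fun h' => not_add_one_modEq_self hn a (h.symm.trans h'), if_pos h]

theorem simpleFun_of_not_modEq {n : ℕ} {a c : ℤ} (h : ¬ c ≡ a [ZMOD n])
    (h' : ¬ c ≡ a + 1 [ZMOD n]) : simpleFun n a c = c := by
  rw [simpleFun, if_neg h, if_neg h']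

/-- The simple reflection `s_a`, indexed by an integer `a`. -/
def simpleInt {n : ℕ} (hn : 2 ≤ n) (a : ℤ) : affineSymmetricGroup n :=
  ⟨(simpleFun_involutive hn a).toPerm, simple_mem hn a⟩

theorem simpleInt_apply {n : ℕ} (hn : 2 ≤ n) (a c : ℤ) :
    (simpleInt hn a : Equiv.Perm ℤ) c = simpleFun n a c := rfl

theorem simpleInt_congr {n : ℕ} (hn : 2 ≤ n) {a b : ℤ} (h : a ≡ b [ZMOD n]) :
    simpleInt hn a = simpleInt hn b := by
  ext c
  have h1 : c ≡ a [ZMOD n] ↔ c ≡ b [ZMOD n] := ⟨fun h' => h'.trans h, fun h' => h'.trans h.symm⟩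
  have h2 : c ≡ a + 1 [ZMOD n] ↔ c ≡ b + 1 [ZMOD n] :=
    ⟨fun h' => h'.trans (h.add_right 1), fun h' => h'.trans (h.add_right 1).symm⟩
  simp only [simpleInt_apply, simpleFun, h1, h2]

theorem exists_fin_modEq {n : ℕ} (hn : 2 ≤ n) (a : ℤ) : ∃ k : Fin n, (k : ℤ) ≡ a [ZMOD n] := by
  have h0 : (0 : ℤ) < n := by omega
  have h1 := Int.emod_nonneg a h0.ne'
  have h2 := Int.emod_lt_of_pos a h0
  refine ⟨⟨(a % n).toNat, by omega⟩, ?_⟩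
  simp only [Int.toNat_of_nonneg h1]
  exact Int.mod_modEq a n

theorem simpleInt_mem_simples {n : ℕ} (hn : 2 ≤ n) (a : ℤ) : simpleInt hn a ∈ simples hn := by
  obtain ⟨k, hk⟩ := exists_fin_modEq hn a
  exact ⟨k, simpleInt_congr hn hk⟩

theorem simpleInt_mul_self {n : ℕ} (hn : 2 ≤ n) (a : ℤ) :
    simpleInt hn a * simpleInt hn a = 1 := by
  ext c
  exact simpleFun_involutive hn a c

theorem simpleInt_inv {n : ℕ} (hn : 2 ≤ n) (a : ℤ) : (simpleInt hn a)⁻¹ = simpleInt hn a :=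
  inv_eq_of_mul_eq_one_right (simpleInt_mul_self hn a)

theorem map_add_mul {n : ℕ} {w : ℤ → ℤ} (hw : ∀ i, w (i + n) = w i + n) (i k : ℤ) :
    w (i + k * n) = w i + k * n := by
  have hp : Function.Periodic (fun i => w i - i) (n : ℤ) := fun i => by
    simp only [hw]
    ring
  have := hp.int_mul k i
  simp only [Int.cast_id] at this
  linarith

theorem modEq_iff_map_modEq {n : ℕ} (w : affineSymmetricGroup n) (i j : ℤ) :
    (w : Equiv.Perm ℤ) i ≡ (w : Equiv.Perm ℤ) j [ZMOD n] ↔ i ≡ j [ZMOD n] := by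
  constructor
  · intro h
    obtain ⟨k, hk⟩ := h.dvd
    have h1 : (w : Equiv.Perm ℤ) j = (w : Equiv.Perm ℤ) (i + k * n) := by
      rw [map_add_mul w.2.1]
      linarith
    rw [w.1.injective h1, Int.modEq_iff_dvd]
    exact ⟨k, by ring⟩
  · intro h
    obtain ⟨k, hk⟩ := h.dvd
    have h1 : j = i + k * n := by linarith
    rw [h1, map_add_mul w.2.1, Int.modEq_iff_dvd]
    exact ⟨k, by ring⟩

theorem map_lt_map_add_one_congr {n : ℕ} (w : affineSymmetricGroup n) {a b : ℤ}
    (h : a ≡ b [ZMOD n]) :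
    (w : Equiv.Perm ℤ) a < (w : Equiv.Perm ℤ) (a + 1) ↔
      (w : Equiv.Perm ℤ) b < (w : Equiv.Perm ℤ) (b + 1) := by
  obtain ⟨k, hk⟩ := h.dvd
  have h1 : b = a + k * n := by linarith
  rw [h1, show a + k * n + 1 = a + 1 + k * n by ring, map_add_mul w.2.1, map_add_mul w.2.1]
  omega

theorem sum_modEq {n : ℕ} (hn : 2 ≤ n) (a : ℤ) :
    ∑ c ∈ Icc (1 : ℤ) n, (if c ≡ a [ZMOD n] then (1 : ℤ) else 0) = 1 := by
  have h0 : (0 : ℤ) < n := by omega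
  have h1 := Int.emod_nonneg (a - 1) h0.ne'
  have h2 := Int.emod_lt_of_pos (a - 1) h0
  rw [sum_eq_single ((a - 1) % n + 1)]
  · rw [if_pos]
    simpa using (Int.mod_modEq (a - 1) n).add_right 1
  · intro b hb hne
    rw [if_neg]
    intro h
    apply hne
    rw [mem_Icc] at hb
    have h3 : (b - 1) % n = (a - 1) % n := h.sub_right 1
    rw [← h3, Int.emod_eq_of_lt (by omega) (by omega)]
    ring
  · intro h
    exact absurd (mem_Icc.2 ⟨by omega, by omega⟩) h

/-! ### Inversions and the length function -/

/-- The inversions of `w` with first entry `c`. -/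
def inversionsAt (w : ℤ → ℤ) (c : ℤ) : Set ℤ := {b | c < b ∧ w b < w c}

/-- The number of inversions of `w` up to simultaneous translation by `n`. -/
noncomputable def inversionNumber {n : ℕ} (w : affineSymmetricGroup n) : ℕ :=
  ∑ c ∈ Icc (1 : ℤ) n, (inversionsAt (w : Equiv.Perm ℤ) c).ncard

/-- The displacement `b - w b` is periodic, so one period bounds it. This makes each set of
inversions finite, and `ncard` meaningful on it. -/
theorem exists_sub_le {n : ℕ} (hn : 2 ≤ n) (w : affineSymmetricGroup n) :
    ∃ M : ℤ, ∀ b, b - (w : Equiv.Perm ℤ) b ≤ M := by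
  have h0 : (0 : ℤ) < n := by omega
  obtain ⟨M, hM⟩ := ((Icc (1 : ℤ) n).image fun b => b - (w : Equiv.Perm ℤ) b).bddAbove
  refine ⟨M, fun b => ?_⟩
  have h1 := Int.emod_nonneg (b - 1) h0.ne'
  have h2 := Int.emod_lt_of_pos (b - 1) h0
  have h3 := Int.emod_add_mul_ediv (b - 1) n
  have h4 : b = (b - 1) % n + 1 + (b - 1) / n * n := by linarith
  have h5 := map_add_mul w.2.1 ((b - 1) % n + 1) ((b - 1) / n)
  rw [← h4] at h5
  have h6 : ((b - 1) % n + 1) - (w : Equiv.Perm ℤ) ((b - 1) % n + 1) ≤ M :=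
    hM (mem_coe.2 (mem_image_of_mem _ (mem_Icc.2 ⟨by omega, by omega⟩)))
  linarith

theorem finite_inversionsAt {n : ℕ} (hn : 2 ≤ n) (w : affineSymmetricGroup n) (c : ℤ) :
    (inversionsAt (w : Equiv.Perm ℤ) c).Finite := by
  obtain ⟨M, hM⟩ := exists_sub_le hn w
  refine (Set.finite_Icc c ((w : Equiv.Perm ℤ) c + M)).subset ?_
  rintro b ⟨h1, h2⟩
  have := hM b
  exact ⟨h1.le, by linarith⟩

theorem inversionsAt_periodic {n : ℕ} (w : affineSymmetricGroup n) :
    Function.Periodic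
      (fun c => ((inversionsAt (w : Equiv.Perm ℤ) c).ncard : ℤ)) (n : ℤ) := by
  intro c
  have h : inversionsAt (w : Equiv.Perm ℤ) (c + n) =
      (fun b => b + (n : ℤ)) '' inversionsAt (w : Equiv.Perm ℤ) c := by
    ext b
    simp only [inversionsAt, Set.mem_image, Set.mem_ofPred_eq, w.2.1 c]
    constructor
    · rintro ⟨h1, h2⟩
      have h3 := w.2.1 (b - n)
      rw [sub_add_cancel] at h3
      exact ⟨b - n, ⟨by omega, by omega⟩, by ring⟩
    · rintro ⟨x, ⟨h1, h2⟩, rfl⟩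
      rw [w.2.1]
      omega
  simp only [h]
  rw [Set.ncard_image_of_injective _ (add_left_injective _)]

/-- A simple reflection moves integers by at most one, so it can reverse only the adjacent pairs it
swaps. -/
theorem simpleFun_lt_iff {n : ℕ} (hn : 2 ≤ n) {a b c : ℤ}
    (h1 : ¬ (c ≡ a [ZMOD n] ∧ b = c + 1)) (h2 : ¬ (c ≡ a + 1 [ZMOD n] ∧ b = c - 1)) :
    simpleFun n a c < simpleFun n a b ↔ c < b := by
  have h3 : ∀ x y : ℤ, x ≡ a [ZMOD n] → y ≡ a + 1 [ZMOD n] → x ≠ y := by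
    rintro x y hx hy rfl
    exact not_add_one_modEq_self hn a (hy.symm.trans hx)
  have h4 : c ≡ a + 1 [ZMOD n] → c - 1 ≡ a [ZMOD n] := fun h => by simpa using h.sub_right 1
  have h5 : b ≡ a + 1 [ZMOD n] → b - 1 ≡ a [ZMOD n] := fun h => by simpa using h.sub_right 1
  have h6 : c ≡ a [ZMOD n] → c + 1 ≡ a + 1 [ZMOD n] := fun h => h.add_right 1
  have h7 : b ≡ a [ZMOD n] → b + 1 ≡ a + 1 [ZMOD n] := fun h => h.add_right 1
  unfold simpleFun
  grind

theorem mul_simpleInt_apply_simpleFun {n : ℕ} (hn : 2 ≤ n) (w : affineSymmetricGroup n)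
    (a c : ℤ) :
    ((w * simpleInt hn a : affineSymmetricGroup n) : Equiv.Perm ℤ) (simpleFun n a c) =
      (w : Equiv.Perm ℤ) c := by
  change (w : Equiv.Perm ℤ) (simpleFun n a (simpleFun n a c)) = _
  rw [simpleFun_involutive hn a c]

theorem inversionsAt_mul_simpleInt {n : ℕ} (hn : 2 ≤ n) (w : affineSymmetricGroup n)
    (a c : ℤ) :
    (inversionsAt ((w * simpleInt hn a : affineSymmetricGroup n) : Equiv.Perm ℤ)
      (simpleFun n a c)).ncard =
      {b | simpleFun n a c < simpleFun n a b ∧ (w : Equiv.Perm ℤ) b < (w : Equiv.Perm ℤ) c}.ncard := by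
  rw [← Set.ncard_image_of_injective {b | simpleFun n a c < simpleFun n a b ∧ _}
    (simpleFun_involutive hn a).injective]
  congr 1
  ext b
  simp only [Set.mem_image, inversionsAt, Set.mem_ofPred_eq, mul_simpleInt_apply_simpleFun]
  constructor
  · rintro ⟨h1, h2⟩
    have h3 := simpleFun_involutive hn a b
    refine ⟨simpleFun n a b, ⟨by rwa [h3], ?_⟩, h3⟩
    rwa [← h3, mul_simpleInt_apply_simpleFun] at h2
  · rintro ⟨x, ⟨h1, h2⟩, rfl⟩
    exact ⟨h1, by rwa [mul_simpleInt_apply_simpleFun]⟩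

/-- After both entries are reindexed by `s_a`, only swapped adjacent pairs can change status. An
inversion is charged to its first entry: a new one to the class of `a + 1`, which now comes first,
and a lost one to the class of `a`. -/
theorem ncard_inversionsAt_mul_simpleInt {n : ℕ} (hn : 2 ≤ n) (w : affineSymmetricGroup n)
    (a c : ℤ) :
    ((inversionsAt ((w * simpleInt hn a : affineSymmetricGroup n) : Equiv.Perm ℤ)
      (simpleFun n a c)).ncard : ℤ) =
      (inversionsAt (w : Equiv.Perm ℤ) c).ncard +
        (if (w : Equiv.Perm ℤ) a < (w : Equiv.Perm ℤ) (a + 1) then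
          (if c ≡ a + 1 [ZMOD n] then 1 else 0) else -(if c ≡ a [ZMOD n] then 1 else 0)) := by
  have hfin := finite_inversionsAt hn w c
  rw [inversionsAt_mul_simpleInt]
  by_cases h1 : c ≡ a [ZMOD n]
  · have h2 : ¬ c ≡ a + 1 [ZMOD n] := fun h =>
      not_add_one_modEq_self hn a (h.symm.trans h1)
    have h3 : {b | simpleFun n a c < simpleFun n a b ∧
        (w : Equiv.Perm ℤ) b < (w : Equiv.Perm ℤ) c} =
        inversionsAt (w : Equiv.Perm ℤ) c \ {c + 1} := by
      ext b
      simp only [inversionsAt, Set.mem_ofPred_eq, Set.mem_sdiff, Set.mem_singleton_iff]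
      by_cases hb : b = c + 1
      · subst hb
        rw [simpleFun_of_modEq h1, simpleFun_of_modEq_add_one hn (h1.add_right 1)]
        simp
      · rw [simpleFun_lt_iff hn (fun h => hb h.2) (fun h => h2 h.1)]
        simp [hb]
    rw [h3]
    simp only [← map_lt_map_add_one_congr w h1, h1, h2, if_true, if_false]
    split_ifs with h4
    · rw [Set.sdiff_singleton_eq_self]
      · ring
      · rintro ⟨_, h⟩
        exact absurd h h4.not_gt
    · have hmem : c + 1 ∈ inversionsAt (w : Equiv.Perm ℤ) c :=
        ⟨by omega, lt_of_le_of_ne (not_lt.1 h4) fun h => by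
          have := w.1.injective h
          omega⟩
      have h5 := Set.ncard_sdiff_singleton_add_one hmem hfin
      omega
  · by_cases h2 : c ≡ a + 1 [ZMOD n]
    · have h2' : c - 1 ≡ a [ZMOD n] := by simpa using h2.sub_right 1
      simp only [← map_lt_map_add_one_congr w h2', sub_add_cancel, h1, h2, if_true, if_false]
      have h3 : ∀ b, b ≠ c - 1 → (simpleFun n a c < simpleFun n a b ↔ c < b) := fun b hb =>
        simpleFun_lt_iff hn (fun h => h1 h.1) (fun h => hb h.2)
      have h4 : simpleFun n a c < simpleFun n a (c - 1) := by
        rw [simpleFun_of_modEq h2', simpleFun_of_modEq_add_one hn h2]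
        omega
      split_ifs with h5
      · have h6 : {b | simpleFun n a c < simpleFun n a b ∧
            (w : Equiv.Perm ℤ) b < (w : Equiv.Perm ℤ) c} =
            insert (c - 1) (inversionsAt (w : Equiv.Perm ℤ) c) := by
          ext b
          simp only [inversionsAt, Set.mem_ofPred_eq, Set.mem_insert_iff]
          by_cases hb : b = c - 1
          · subst hb
            simp [h4, h5]
          · simp [h3 b hb, hb]
        rw [h6, Set.ncard_insert_of_notMem _ hfin]
        · push_cast
          ring
        · rintro ⟨h, _⟩
          omega
      · have h6 : {b | simpleFun n a c < simpleFun n a b ∧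
            (w : Equiv.Perm ℤ) b < (w : Equiv.Perm ℤ) c} =
            inversionsAt (w : Equiv.Perm ℤ) c := by
          ext b
          simp only [inversionsAt, Set.mem_ofPred_eq]
          by_cases hb : b = c - 1
          · subst hb
            simp [h5]
          · simp [h3 b hb]
        rw [h6]
        simp
    · have h6 : {b | simpleFun n a c < simpleFun n a b ∧
          (w : Equiv.Perm ℤ) b < (w : Equiv.Perm ℤ) c} = inversionsAt (w : Equiv.Perm ℤ) c := by
        ext b
        simp only [inversionsAt, Set.mem_ofPred_eq]
        rw [simpleFun_lt_iff hn (fun h => h1 h.1) (fun h => h2 h.1)]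
      simp [h6, h1, h2]

theorem inversionNumber_mul_simpleInt {n : ℕ} (hn : 2 ≤ n) (w : affineSymmetricGroup n)
    (a : ℤ) :
    (inversionNumber (w * simpleInt hn a) : ℤ) = inversionNumber w +
      (if (w : Equiv.Perm ℤ) a < (w : Equiv.Perm ℤ) (a + 1) then 1 else -1) := by
  -- Periodicity lets the sum be taken over `s_a c` instead of `c`, the form in which the local
  -- change is known.
  have h := sum_comp_eq (inversionsAt_periodic (w * simpleInt hn a))
    (w := (simpleInt hn a : Equiv.Perm ℤ)) (simpleInt hn a).2.1 (simpleInt hn a).1.injective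
  simp only [simpleInt_apply, ncard_inversionsAt_mul_simpleInt, sum_add_distrib] at h
  unfold inversionNumber
  rw [Nat.cast_sum, Nat.cast_sum, ← h]
  split_ifs
  · rw [sum_modEq hn]
  · rw [sum_neg_distrib, sum_modEq hn]

/-- Without descents `w` is an increasing bijection of `ℤ`, hence a translation, and the
normalization of the sum leaves only the trivial one. -/
theorem exists_descent {n : ℕ} {w : affineSymmetricGroup n} (hn : 2 ≤ n) (hw : w ≠ 1) :
    ∃ a : ℤ, (w : Equiv.Perm ℤ) (a + 1) < (w : Equiv.Perm ℤ) a := by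
  by_contra! hcon
  apply hw
  have hmono : StrictMono (w : Equiv.Perm ℤ) := strictMono_int_of_lt_succ fun a =>
    lt_of_le_of_ne (hcon a) fun h => by
      have := w.1.injective h
      omega
  have hsucc : ∀ a, (w : Equiv.Perm ℤ) (a + 1) = (w : Equiv.Perm ℤ) a + 1 := by
    intro a
    obtain ⟨k, hk⟩ := w.1.surjective ((w : Equiv.Perm ℤ) a + 1)
    have h1 : a < k := hmono.lt_iff_lt.1 (by omega)
    have h2 : (w : Equiv.Perm ℤ) (a + 1) ≤ (w : Equiv.Perm ℤ) k := hmono.monotone (by omega)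
    have h3 := hmono (lt_add_one a)
    omega
  -- Commuting with the unit shift is the case of period `1`.
  have htrans : ∀ a, (w : Equiv.Perm ℤ) a = a + (w : Equiv.Perm ℤ) 0 := fun a => by
    simpa [add_comm] using map_add_mul (n := 1) (w := (w : Equiv.Perm ℤ)) (by simpa using hsucc) 0 a
  have hsum := w.2.2
  rw [sum_congr rfl fun a _ => htrans a] at hsum
  simp only [sum_add_distrib, sum_const, Int.card_Icc] at hsum
  have h0 : (w : Equiv.Perm ℤ) 0 = 0 := by
    have h1 : ((n : ℤ) + 1 - 1).toNat = n := by omega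
    rw [h1] at hsum
    rcases (by simpa using hsum : n = 0 ∨ (w : Equiv.Perm ℤ) 0 = 0) with h | h
    · omega
    · exact h
  ext a
  rw [htrans, h0]
  simp

theorem inversionNumber_one (n : ℕ) : inversionNumber (1 : affineSymmetricGroup n) = 0 := by
  refine sum_eq_zero fun c _ => ?_
  have : inversionsAt ((1 : affineSymmetricGroup n) : Equiv.Perm ℤ) c = ∅ := by
    ext b
    simp only [inversionsAt, Subgroup.coe_one, Equiv.Perm.coe_one, id_eq, Set.mem_ofPred_eq,
      Set.mem_empty_iff_false, iff_false]
    omega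
  rw [this, Set.ncard_empty]

theorem inversionNumber_prod_le {n : ℕ} (hn : 2 ≤ n) (l : List (affineSymmetricGroup n))
    (hl : ∀ s ∈ l, s ∈ simples hn) : inversionNumber l.prod ≤ l.length := by
  induction l using List.reverseRecOn with
  | nil => simp [inversionNumber_one]
  | append_singleton l s ih =>
    obtain ⟨k, rfl⟩ := hl s (by simp)
    have h1 := ih fun s hs => hl s (by simp [hs])
    have h2 := inversionNumber_mul_simpleInt hn l.prod (k : ℕ)
    rw [List.prod_append, List.prod_singleton, List.length_append, List.length_singleton]
    change inversionNumber (l.prod * simpleInt hn (k : ℕ)) ≤ _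
    split_ifs at h2 <;> omega

theorem exists_word {n : ℕ} (hn : 2 ≤ n) (w : affineSymmetricGroup n) :
    ∃ l : List (affineSymmetricGroup n),
      (∀ s ∈ l, s ∈ simples hn) ∧ l.length = inversionNumber w ∧ l.prod = w := by
  induction hk : inversionNumber w using Nat.strong_induction_on generalizing w with
  | _ k ih =>
    subst hk
    by_cases hw : w = 1
    · subst hw
      exact ⟨[], by simp, by simp [inversionNumber_one], rfl⟩
    · obtain ⟨a, ha⟩ := exists_descent hn hw
      have h1 := inversionNumber_mul_simpleInt hn w a
      rw [if_neg ha.not_gt] at h1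
      obtain ⟨l, hl, hlen, hprod⟩ := ih _ (by omega) (w * simpleInt hn a) rfl
      refine ⟨l ++ [simpleInt hn a], ?_, ?_, ?_⟩
      · intro s hs
        rcases List.mem_append.1 hs with h | h
        · exact hl s h
        · rw [List.mem_singleton.1 h]
          exact simpleInt_mem_simples hn a
      · rw [List.length_append, List.length_singleton]
        omega
      · rw [List.prod_append, List.prod_singleton, hprod, mul_assoc, simpleInt_mul_self, mul_one]

/-- The length of an affine permutation is its number of inversions. -/
theorem length_eq_inversionNumber {n : ℕ} (hn : 2 ≤ n) (w : affineSymmetricGroup n) :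
    TwistedCoxeter.length (simples hn) w = inversionNumber w := by
  have hmem := exists_word hn w
  refine le_antisymm (Nat.sInf_le hmem) (le_csInf ⟨_, hmem⟩ ?_)
  rintro k ⟨l, hl, rfl, rfl⟩
  exact inversionNumber_prod_le hn l hl

/-- Reversing a shortest word for `w` gives a word for `w⁻¹`. -/
theorem inversionNumber_inv_le {n : ℕ} (hn : 2 ≤ n) (w : affineSymmetricGroup n) :
    inversionNumber w⁻¹ ≤ inversionNumber w := by
  obtain ⟨l, hl, hlen, rfl⟩ := exists_word hn w
  rw [List.prod_inv_reverse, ← hlen]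
  refine (inversionNumber_prod_le hn _ ?_).trans (by simp)
  intro s hs
  obtain ⟨t, ht, rfl⟩ := List.mem_map.1 (List.mem_reverse.1 hs)
  obtain ⟨k, rfl⟩ := hl t ht
  change (simpleInt hn (k : ℕ))⁻¹ ∈ _
  rw [simpleInt_inv]
  exact simpleInt_mem_simples hn _

theorem inversionNumber_inv {n : ℕ} (hn : 2 ≤ n) (w : affineSymmetricGroup n) :
    inversionNumber w⁻¹ = inversionNumber w :=
  (inversionNumber_inv_le hn w).antisymm (by simpa using inversionNumber_inv_le hn w⁻¹)

end AffineSymmetric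
-- Twisted involutions and the antifixed count
namespace TwistedCoxeter

variable {W : Type*} [Group W]

theorem mul_mem_twistedInvolutions_iff {θ : W ≃* W} {s w : W} (hs : s⁻¹ = s)
    (hw : w ∈ twistedInvolutions θ) : w * s ∈ twistedInvolutions θ ↔ w * s = θ s * w := by
  have hw' : w⁻¹ = θ w := hw
  rw [twistedInvolutions, Set.mem_ofPred_eq, map_mul, ← hw', mul_inv_rev, hs]
  rw [eq_inv_mul_iff_mul_eq, ← mul_assoc, mul_inv_eq_iff_eq_mul]

theorem conj_mem_twistedInvolutions {θ : W ≃* W} (hθ : ∀ x, θ (θ x) = x) {s w : W}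
    (hs : s⁻¹ = s) (hw : w ∈ twistedInvolutions θ) : s * w * θ s ∈ twistedInvolutions θ := by
  have hw' : w⁻¹ = θ w := hw
  rw [twistedInvolutions, Set.mem_ofPred_eq, map_mul, map_mul, hθ, ← hw', mul_inv_rev,
    mul_inv_rev, ← map_inv, hs, mul_assoc]

end TwistedCoxeter

namespace AffineSymmetric

open Finset TwistedCoxeter

theorem star_apply {n : ℕ} (w : affineSymmetricGroup n) (c : ℤ) :
    (star n w : Equiv.Perm ℤ) c = n + 1 - (w : Equiv.Perm ℤ) (n + 1 - c) := rfl

theorem star_star {n : ℕ} (w : affineSymmetricGroup n) : star n (star n w) = w :=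
  (star n).left_inv w

/-- The reflection `c ↦ n + 1 - c` exchanges the class of `a` with that of `1 - a`, and the class of
`a + 1` with that of `-a`. -/
theorem star_simpleInt {n : ℕ} (hn : 2 ≤ n) (a : ℤ) :
    star n (simpleInt hn a) = simpleInt hn (-a) := by
  ext c
  rw [star_apply, simpleInt_apply, simpleInt_apply]
  have h1 : (n : ℤ) + 1 - c ≡ a [ZMOD n] ↔ c ≡ -a + 1 [ZMOD n] := by
    rw [Int.modEq_comm, Int.modEq_iff_dvd, Int.modEq_iff_dvd, ← dvd_sub_self_left, ← dvd_neg]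
    congr! 1
    ring
  have h2 : (n : ℤ) + 1 - c ≡ a + 1 [ZMOD n] ↔ c ≡ -a [ZMOD n] := by
    rw [Int.modEq_comm, Int.modEq_iff_dvd, Int.modEq_iff_dvd, ← dvd_sub_self_left, ← dvd_neg]
    congr! 1
    ring
  by_cases h3 : c ≡ -a [ZMOD n]
  · rw [simpleFun_of_modEq h3, simpleFun_of_modEq_add_one hn (h2.2 h3)]
    ring
  · by_cases h4 : c ≡ -a + 1 [ZMOD n]
    · rw [simpleFun_of_modEq_add_one hn h4, simpleFun_of_modEq (h1.2 h4)]
      ring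
    · rw [simpleFun_of_not_modEq h3 h4, simpleFun_of_not_modEq (h1.not.2 h4) (h2.not.2 h3)]
      ring

/-- The number of `i` modulo `n` with `w i ≡ 1 - i`. -/
noncomputable def antifixedCount {n : ℕ} (w : affineSymmetricGroup n) : ℕ :=
  #{i ∈ Icc (1 : ℤ) n | (w : Equiv.Perm ℤ) i ≡ 1 - i [ZMOD n]}

/-- The indicator function of `w i ≡ 1 - i` modulo `n`. -/
def antifixed {n : ℕ} (w : affineSymmetricGroup n) (i : ℤ) : ℤ :=
  if (w : Equiv.Perm ℤ) i ≡ 1 - i [ZMOD n] then 1 else 0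

theorem antifixedCount_eq_sum {n : ℕ} (w : affineSymmetricGroup n) :
    (antifixedCount w : ℤ) = ∑ i ∈ Icc (1 : ℤ) n, antifixed w i := by
  simp only [antifixedCount, antifixed, sum_boole]

theorem antifixed_congr {n : ℕ} (w : affineSymmetricGroup n) {i j : ℤ} (h : i ≡ j [ZMOD n]) :
    antifixed w i = antifixed w j := by
  have h1 := (modEq_iff_map_modEq w i j).2 h
  have h2 : 1 - i ≡ 1 - j [ZMOD n] := h.sub_left 1
  simp only [antifixed, show (w : Equiv.Perm ℤ) i ≡ 1 - i [ZMOD n] ↔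
    (w : Equiv.Perm ℤ) j ≡ 1 - j [ZMOD n] from
    ⟨fun h' => h1.symm.trans (h'.trans h2), fun h' => h1.trans (h'.trans h2.symm)⟩]

theorem antifixed_periodic {n : ℕ} (w : affineSymmetricGroup n) :
    Function.Periodic (antifixed w) (n : ℤ) := fun i =>
  antifixed_congr w (by simp [Int.ModEq])

theorem antifixedCount_conj {n : ℕ} (s w : affineSymmetricGroup n) (hs : s⁻¹ = s) :
    antifixedCount (s * w * star n s) = antifixedCount w := by
  zify
  -- Reindexing by `s^*` matches `c` for `w` with `s^* c` for the conjugate.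
  rw [antifixedCount_eq_sum, antifixedCount_eq_sum, ← sum_comp_eq (antifixed_periodic _)
    (star n s).2.1 (star n s).1.injective]
  refine sum_congr rfl fun c _ => ?_
  have hss : star n s * star n s = 1 := by
    rw [← map_mul, ← mul_eq_one_iff_inv_eq.2 hs, mul_eq_one_iff_inv_eq.2 hs, map_one]
  have h1 : ((s * w * star n s : affineSymmetricGroup n) : Equiv.Perm ℤ)
      ((star n s : Equiv.Perm ℤ) c) = (s : Equiv.Perm ℤ) ((w : Equiv.Perm ℤ) c) := by
    have : ((s * w * star n s * star n s : affineSymmetricGroup n) : Equiv.Perm ℤ) c =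
        (s : Equiv.Perm ℤ) ((w : Equiv.Perm ℤ) c) := by
      rw [mul_assoc, hss, mul_one]
      rfl
    exact this
  have h2 : 1 - (star n s : Equiv.Perm ℤ) c ≡ (s : Equiv.Perm ℤ) (1 - c) [ZMOD n] := by
    rw [star_apply, show (n : ℤ) + 1 - c = 1 - c + n by ring, s.2.1,
      show (1 : ℤ) - (n + 1 - ((s : Equiv.Perm ℤ) (1 - c) + n)) = (s : Equiv.Perm ℤ) (1 - c) by ring]
  simp only [antifixed, h1]
  congr 1
  rw [← modEq_iff_map_modEq s _ (1 - c)]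
  exact propext ⟨fun h => h.trans h2, fun h => h.trans h2.symm⟩

theorem modEq_of_mul_simpleInt_eq {n : ℕ} (hn : 2 ≤ n) {w : affineSymmetricGroup n} {a b : ℤ}
    (h : w * simpleInt hn a = simpleInt hn b * w) :
    ((w : Equiv.Perm ℤ) a ≡ b [ZMOD n] ∧ (w : Equiv.Perm ℤ) (a + 1) = (w : Equiv.Perm ℤ) a + 1) ∨
      ((w : Equiv.Perm ℤ) a ≡ b + 1 [ZMOD n] ∧
        (w : Equiv.Perm ℤ) (a + 1) = (w : Equiv.Perm ℤ) a - 1) := by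
  have h1 : (w : Equiv.Perm ℤ) (simpleFun n a a) = simpleFun n b ((w : Equiv.Perm ℤ) a) :=
    congrArg (fun v : affineSymmetricGroup n => (v : Equiv.Perm ℤ) a) h
  rw [simpleFun_of_modEq rfl] at h1
  by_cases h2 : (w : Equiv.Perm ℤ) a ≡ b [ZMOD n]
  · exact Or.inl ⟨h2, by rw [h1, simpleFun_of_modEq h2]⟩
  · by_cases h3 : (w : Equiv.Perm ℤ) a ≡ b + 1 [ZMOD n]
    · exact Or.inr ⟨h3, by rw [h1, simpleFun_of_modEq_add_one hn h3]⟩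
    · rw [simpleFun_of_not_modEq h2 h3] at h1
      have := w.1.injective h1
      omega

/-- Converse of the decreasing case above, used to exclude the exceptional pair in
`inversionNumber_conj_lt`. -/
theorem mul_simpleInt_eq {n : ℕ} (hn : 2 ≤ n) {w : affineSymmetricGroup n} {a b : ℤ}
    (h : (w : Equiv.Perm ℤ) a ≡ b + 1 [ZMOD n])
    (h' : (w : Equiv.Perm ℤ) (a + 1) = (w : Equiv.Perm ℤ) a - 1) :
    w * simpleInt hn a = simpleInt hn b * w := by
  have h'' : (w : Equiv.Perm ℤ) (a + 1) ≡ b [ZMOD n] := by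
    rw [h']
    simpa using h.sub_right 1
  ext c
  change (w : Equiv.Perm ℤ) (simpleFun n a c) = simpleFun n b ((w : Equiv.Perm ℤ) c)
  have key : ∀ i j : ℤ, i ≡ j [ZMOD n] →
      (w : Equiv.Perm ℤ) j - (w : Equiv.Perm ℤ) i = j - i := by
    intro i j hij
    obtain ⟨k, hk⟩ := hij.dvd
    rw [show j = i + k * n by linarith, map_add_mul w.2.1]
    ring
  by_cases h1 : c ≡ a [ZMOD n]
  · have h2 := ((modEq_iff_map_modEq w c a).2 h1).trans h
    rw [simpleFun_of_modEq h1, simpleFun_of_modEq_add_one hn h2]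
    linarith [key c a h1, key (c + 1) (a + 1) (h1.add_right 1)]
  · by_cases h2 : c ≡ a + 1 [ZMOD n]
    · have h3 := ((modEq_iff_map_modEq w c (a + 1)).2 h2).trans h''
      rw [simpleFun_of_modEq_add_one hn h2, simpleFun_of_modEq h3]
      have h4 : c - 1 ≡ a [ZMOD n] := by simpa using h2.sub_right 1
      linarith [key c (a + 1) h2, key (c - 1) a h4]
    · rw [simpleFun_of_not_modEq h1 h2, simpleFun_of_not_modEq]
      · exact fun h3 => h2 ((modEq_iff_map_modEq w c (a + 1)).1 (h3.trans h''.symm))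
      · exact fun h3 => h1 ((modEq_iff_map_modEq w c a).1 (h3.trans h.symm))

theorem antifixedCount_mul_simpleInt_of_lt {n : ℕ} (hn : 2 ≤ n) {w : affineSymmetricGroup n}
    {a : ℤ} (h : (w : Equiv.Perm ℤ) a ≡ -a [ZMOD n])
    (h' : (w : Equiv.Perm ℤ) (a + 1) = (w : Equiv.Perm ℤ) a + 1) :
    antifixedCount (w * simpleInt hn a) = antifixedCount w + 2 := by
  have hne : ¬ -a ≡ 1 - a [ZMOD n] := fun h1 =>
    not_add_one_modEq_self hn (-a) (by rw [show -a + 1 = 1 - a by ring]; exact h1.symm)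
  have hwa : antifixed w a = 0 := if_neg fun h1 => hne (h.symm.trans h1)
  have h'' : (w : Equiv.Perm ℤ) (a + 1) ≡ 1 - a [ZMOD n] := by
    rw [h', show (1 : ℤ) - a = -a + 1 by ring]
    exact h.add_right 1
  have hwa' : antifixed w (a + 1) = 0 := if_neg fun h1 => hne <| by
    rw [show (1 : ℤ) - (a + 1) = -a by ring] at h1
    exact h1.symm.trans h''
  have hsa : antifixed (w * simpleInt hn a) a = 1 := by
    refine if_pos ?_
    change (w : Equiv.Perm ℤ) (simpleFun n a a) ≡ _ [ZMOD n]
    rwa [simpleFun_of_modEq rfl]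
  have hsa' : antifixed (w * simpleInt hn a) (a + 1) = 1 := by
    refine if_pos ?_
    change (w : Equiv.Perm ℤ) (simpleFun n a (a + 1)) ≡ _ [ZMOD n]
    rw [simpleFun_of_modEq_add_one hn rfl, add_sub_cancel_right,
      show (1 : ℤ) - (a + 1) = -a by ring]
    exact h
  have key : ∀ c, antifixed (w * simpleInt hn a) c = antifixed w c +
      ((if c ≡ a [ZMOD n] then 1 else 0) + (if c ≡ a + 1 [ZMOD n] then 1 else 0)) := by
    intro c
    by_cases h1 : c ≡ a [ZMOD n]
    · have h2 : ¬ c ≡ a + 1 [ZMOD n] := fun h2 =>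
        not_add_one_modEq_self hn a (h2.symm.trans h1)
      rw [if_pos h1, if_neg h2, antifixed_congr _ h1, antifixed_congr w h1, hwa, hsa]
      norm_num
    · by_cases h2 : c ≡ a + 1 [ZMOD n]
      · rw [if_neg h1, if_pos h2, antifixed_congr _ h2, antifixed_congr w h2, hwa', hsa']
        norm_num
      · have h3 : ((w * simpleInt hn a : affineSymmetricGroup n) : Equiv.Perm ℤ) c =
            (w : Equiv.Perm ℤ) c := by
          change (w : Equiv.Perm ℤ) (simpleFun n a c) = _
          rw [simpleFun_of_not_modEq h1 h2]
        rw [if_neg h1, if_neg h2, antifixed, h3, antifixed]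
        norm_num
  zify
  rw [antifixedCount_eq_sum, antifixedCount_eq_sum, sum_congr rfl fun c _ => key c,
    sum_add_distrib, sum_add_distrib, sum_modEq hn, sum_modEq hn]
  norm_num

theorem antifixedCount_one {n : ℕ} : antifixedCount (1 : affineSymmetricGroup n) ≤ 1 := by
  refine card_le_one.2 fun i hi j hj => ?_
  simp only [mem_filter, mem_Icc, Subgroup.coe_one, Equiv.Perm.coe_one, id_eq,
    Int.modEq_iff_dvd] at hi hj
  obtain ⟨⟨hi1, hi2⟩, k, hk⟩ := hi
  obtain ⟨⟨hj1, hj2⟩, m, hm⟩ := hj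
  have h1 : 2 * (i - j) = n * (m - k) := by linarith
  have h2 : m - k < 2 := by nlinarith
  have h3 : -2 < m - k := by nlinarith
  -- A solution of `2 * i ≡ 1` forces `n` to be odd, so `2 * (i - j) = ± n` is impossible.
  have h4 : (n : ℤ) % 2 = 1 := by
    rcases Int.emod_two_eq_zero_or_one n with h | h
    · obtain ⟨t, ht⟩ := Int.dvd_of_emod_eq_zero h
      have : 2 * (t * k) = 1 - i - i := by rw [hk, ht]; ring
      omega
    · exact h
  obtain h5 | h5 | h5 : m - k = -1 ∨ m - k = 0 ∨ m - k = 1 := by omega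
  all_goals
    rw [h5] at h1
    omega

theorem length_mul_simpleInt {n : ℕ} (hn : 2 ≤ n) (w : affineSymmetricGroup n) (a : ℤ) :
    (length (simples hn) (w * simpleInt hn a) : ℤ) = length (simples hn) w +
      (if (w : Equiv.Perm ℤ) a < (w : Equiv.Perm ℤ) (a + 1) then 1 else -1) := by
  simpa only [length_eq_inversionNumber] using inversionNumber_mul_simpleInt hn w a

theorem isTwistedAbsoluteLength_antifixedCount {n : ℕ} (hn : 2 ≤ n) :
    IsTwistedAbsoluteLength (simples hn) (star n)
      fun w => antifixedCount (w : affineSymmetricGroup n) / 2 where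
  map_one e he := by
    have := antifixedCount_one (n := n)
    simp only [he]
    omega
  map_conj := by
    rintro _ ⟨k, rfl⟩ w w' h
    simp only [h]
    exact congrArg (· / 2) (antifixedCount_conj _ _ (simpleInt_inv hn (k : ℕ)))
  map_mul := by
    rintro _ ⟨k, rfl⟩ ⟨w, hw⟩ ⟨w', hw'⟩ h
    change w' = w * simpleInt hn (k : ℕ) at h
    subst h
    generalize ((k : ℕ) : ℤ) = a at *
    have hcomm := (mul_mem_twistedInvolutions_iff (simpleInt_inv hn a) hw).1 hw'
    rw [star_simpleInt] at hcomm
    simp only [length_mul_simpleInt]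
    rcases modEq_of_mul_simpleInt_eq hn hcomm with ⟨h1, h2⟩ | ⟨h1, h2⟩
    · rw [antifixedCount_mul_simpleInt_of_lt hn h1 h2, if_pos (by omega)]
      omega
    -- The decreasing case is the increasing case applied to `w * s_a`.
    · have h3 : ((w * simpleInt hn a : affineSymmetricGroup n) : Equiv.Perm ℤ) a =
          (w : Equiv.Perm ℤ) (a + 1) := by
        change (w : Equiv.Perm ℤ) (simpleFun n a a) = _
        rw [simpleFun_of_modEq rfl]
      have h4 : ((w * simpleInt hn a : affineSymmetricGroup n) : Equiv.Perm ℤ) (a + 1) =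
          (w : Equiv.Perm ℤ) a := by
        change (w : Equiv.Perm ℤ) (simpleFun n a (a + 1)) = _
        rw [simpleFun_of_modEq_add_one hn rfl, add_sub_cancel_right]
      have h5 := antifixedCount_mul_simpleInt_of_lt hn (w := w * simpleInt hn a) (a := a)
        (by rw [h3, h2]; simpa using h1.sub_right 1) (by rw [h3, h4, h2]; ring)
      rw [mul_assoc, simpleInt_mul_self, mul_one] at h5
      rw [h5, if_neg (by omega)]
      omega

/-! ### Descent by twisted conjugation, and uniqueness -/

/-- As `w⁻¹ = w^*`, a descent of `w` at `a` gives one of `w⁻¹` at `n - a`. It survives left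
multiplication by `s_a` unless the two values are swapped by `s_a`, which would force `w * s_a =
s_a^* * w`. So both multiplications shorten `w`. -/
theorem inversionNumber_conj_lt {n : ℕ} (hn : 2 ≤ n) {w : affineSymmetricGroup n}
    (hw : w ∈ twistedInvolutions (star n)) {a : ℤ}
    (ha : (w : Equiv.Perm ℤ) (a + 1) < (w : Equiv.Perm ℤ) a)
    (hne : w * simpleInt hn a ≠ star n (simpleInt hn a) * w) :
    inversionNumber (star n (simpleInt hn a) * w * simpleInt hn a) < inversionNumber w := by
  have h1 := inversionNumber_mul_simpleInt hn w a
  rw [if_neg ha.not_gt, ← inversionNumber_inv hn (w * _), mul_inv_rev, simpleInt_inv] at h1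
  -- The index `n - a` represents `-a` and is carried by `c ↦ n + 1 - c` to exactly `a + 1`.
  have h2 := inversionNumber_mul_simpleInt hn (simpleInt hn a * w⁻¹) (n - a)
  have hw' : w⁻¹ = star n w := hw
  have h3 : simpleInt hn ((n : ℤ) - a) = star n (simpleInt hn a) := by
    rw [star_simpleInt]
    exact simpleInt_congr hn (Int.modEq_iff_dvd.2 ⟨-1, by ring⟩)
  rw [← inversionNumber_inv hn (_ * simpleInt hn (n - a)), h3, mul_inv_rev, mul_inv_rev, inv_inv,
    simpleInt_inv, ← map_inv, simpleInt_inv, ← mul_assoc] at h2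
  have h4 : ((simpleInt hn a * w⁻¹ : affineSymmetricGroup n) : Equiv.Perm ℤ) (n - a) =
      simpleFun n a (n + 1 - (w : Equiv.Perm ℤ) (a + 1)) := by
    rw [hw']
    change simpleFun n a ((star n w : Equiv.Perm ℤ) (n - a)) = _
    rw [star_apply]
    congr 3
    ring
  have h5 : ((simpleInt hn a * w⁻¹ : affineSymmetricGroup n) : Equiv.Perm ℤ) (n - a + 1) =
      simpleFun n a (n + 1 - (w : Equiv.Perm ℤ) a) := by
    rw [hw']
    change simpleFun n a ((star n w : Equiv.Perm ℤ) (n - a + 1)) = _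
    rw [star_apply]
    congr 3
    ring
  rw [h4, h5, if_neg] at h2
  · omega
  · rw [not_lt]
    refine le_of_lt ((simpleFun_lt_iff hn ?_ ?_).2 (by omega))
    · rintro ⟨h6, h7⟩
      apply hne
      rw [star_simpleInt]
      refine mul_simpleInt_eq hn ?_ (by omega)
      rw [Int.modEq_iff_dvd] at h6 ⊢
      obtain ⟨k, hk⟩ := h6
      exact ⟨-1 - k, by linarith⟩
    · rintro ⟨_, h7⟩
      omega

theorem twistedAbsoluteLength_unique {n : ℕ} (hn : 2 ≤ n)
    {f g : twistedInvolutions (star n) → ℕ}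
    (hf : IsTwistedAbsoluteLength (simples hn) (star n) f)
    (hg : IsTwistedAbsoluteLength (simples hn) (star n) g) : f = g := by
  funext w
  induction hk : inversionNumber (w : affineSymmetricGroup n) using Nat.strong_induction_on
    generalizing w with
  | _ k ih =>
    subst hk
    by_cases hw : (w : affineSymmetricGroup n) = 1
    · rw [hf.map_one w hw, hg.map_one w hw]
    · obtain ⟨a, ha⟩ := exists_descent hn hw
      by_cases hcomm : (w : affineSymmetricGroup n) * simpleInt hn a =
          star n (simpleInt hn a) * w
      · let v : twistedInvolutions (star n) :=
          ⟨w * simpleInt hn a, (mul_mem_twistedInvolutions_iff (simpleInt_inv hn a) w.2).2 hcomm⟩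
        have h1 := hf.map_mul _ (simpleInt_mem_simples hn a) w v rfl
        have h2 := hg.map_mul _ (simpleInt_mem_simples hn a) w v rfl
        have h3 := inversionNumber_mul_simpleInt hn (w : affineSymmetricGroup n) a
        rw [if_neg ha.not_gt] at h3
        have h4 := ih (inversionNumber (v : affineSymmetricGroup n))
          (by simp only [v]; omega) v rfl
        omega
      · have h1 := inversionNumber_conj_lt hn w.2 ha hcomm
        have h2 : star n (simpleInt hn a) * w * simpleInt hn a ∈ twistedInvolutions (star n) := by
          have := conj_mem_twistedInvolutions star_star
            (s := star n (simpleInt hn a)) (by rw [← map_inv, simpleInt_inv]) w.2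
          rwa [star_star] at this
        have hmem : star n (simpleInt hn a) ∈ simples hn := by
          rw [star_simpleInt]
          exact simpleInt_mem_simples hn _
        -- Conjugation is by `s^*`, whose image under the involution is `s`.
        have h3 := hf.map_conj _ hmem w ⟨_, h2⟩ (by rw [star_star])
        have h4 := hg.map_conj _ hmem w ⟨_, h2⟩ (by rw [star_star])
        rw [← h3, ← h4]
        exact ih _ h1 ⟨_, h2⟩ rfl

end AffineSymmetric

theorem proposition2 (n : ℕ) (hn : 2 ≤ n) :
    (∃! f : TwistedCoxeter.twistedInvolutions (AffineSymmetric.star n) → ℕ,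
      TwistedCoxeter.IsTwistedAbsoluteLength
        (AffineSymmetric.simples hn) (AffineSymmetric.star n) f) ∧
    ∀ f : TwistedCoxeter.twistedInvolutions (AffineSymmetric.star n) → ℕ,
      TwistedCoxeter.IsTwistedAbsoluteLength
        (AffineSymmetric.simples hn) (AffineSymmetric.star n) f →
      ∀ w : TwistedCoxeter.twistedInvolutions (AffineSymmetric.star n),
        f w = ((Finset.Icc (1 : ℤ) n).filter
          (fun i => ((w : AffineSymmetric.affineSymmetricGroup n) : Equiv.Perm ℤ) i ≡ 1 - i
            [ZMOD n])).card / 2 := by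
  have h := AffineSymmetric.isTwistedAbsoluteLength_antifixedCount hn
  exact ⟨⟨_, h, fun f hf => AffineSymmetric.twistedAbsoluteLength_unique hn hf h⟩,
    fun f hf w => congrFun (AffineSymmetric.twistedAbsoluteLength_unique hn hf h) w⟩
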